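/- Let $\mathfrak R$ be an associative unital topological ring that is separated and complete and in which the open two-sided ideals form a base of neighborhoods of zero. For a set $X$, let $\mathfrak R[[X]]$ be the set of formal linear combinations $\sum_{x\in X}a_xx$ whose families of coefficients converge to zero (for every neighborhood $U$ of zero in $\mathfrak R$, one has $a_x\in U$ for all but finitely many $x$); the functor $X\mapsto\mathfrak R[[X]]$ is a monad on the category of sets, with the unit $x\mapsto 1\cdot x$ and the "opening of parentheses" as multiplication. A left $\mathfrak R$-contramodule is an algebra $\mathfrak C$, $\pi_{\mathfrak C}\colon\mathfrak R[[\mathfrak C]]\to\mathfrak C$ over this monad; these form an abelian category $\mathfrak R\text{-contra}$. A right $\mathfrak R$-module $\mathcal N$ is discrete if the annihilator of each of its elements is open in $\mathfrak R$. For a discrete right module $\mathcal N$ and a left contramodule $\mathfrak C$, let $\mathcal N\odot_{\mathfrak R}\mathfrak C$ be the cokernel of the difference of the two maps $\mathcal N\otimes_{\mathbb Z}\mathfrak R[[\mathfrak C]]\rightrightarrows\mathcal N\otimes_{\mathbb Z}\mathfrak C$ given by $b\otimes\sum_c r_cc\mapsto b\otimes\pi_{\mathfrak C}(\sum_c r_cc)$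 and $b\otimes\sum_c r_cc\mapsto\sum_c br_c\otimes c$. Let $\mathrm{Ctrtor}^{\mathfrak R}_i(\mathcal N,\mathfrak C)=H_i(\mathcal N\odot_{\mathfrak R}\mathfrak P_\bullet)$, where $\mathfrak P_\bullet$ is a projective resolution of $\mathfrak C$ in $\mathfrak R\text{-contra}$. A left contramodule $\mathfrak F$ is $1$-strictly flat if $\mathrm{Ctrtor}^{\mathfrak R}_1(\mathcal N,\mathfrak F)=0$ for all discrete right $\mathfrak R$-modules $\mathcal N$. A projective cover of $\mathfrak F$ is an epimorphism $p\colon\mathfrak P\to\mathfrak F$ in $\mathfrak R\text{-contra}$ with $\mathfrak P$ projective such that every endomorphism $e$ of $\mathfrak P$ with $pe=p$ is an automorphism. Let $\mathfrak F$ be a $1$-strictly flat left $\mathfrak R$-contramodule, and let $p\colon\mathfrak P\to\mathfrak F$ be a projective cover of $\mathfrak F$ in $\mathfrak R\text{-contra}$. Then $p$ is an isomorphism, and the $\mathfrak R$-contramodule $\mathfrak F\cong\mathfrak P$ is projective. -/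

import Mathlib

open Filter Topology TensorProduct CategoryTheory

universe u v w

namespace Contra

noncomputable section

/-! ## Convergent formal linear combinations

`R` is a complete, separated topological ring in which the open right ideals form a base of
neighbourhoods of zero.  (A topological abelian group carries exactly one uniformity compatible
with the addition, so `[UniformSpace R] [IsUniformAddGroup R]` is no additional datum;
`IsLinearTopology Rᵐᵒᵖ R` says that the open right ideals are a base at zero.) -/

section FormalSums

variable (R : Type u) [Ring R] [UniformSpace R] [IsUniformAddGroup R] [IsTopologicalRing R]
  [CompleteSpace R] [T2Space R] [IsLinearTopology Rᵐᵒᵖ R]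

/-- The group `R[[X]]` of formal linear combinations `∑ aₓ x` whose coefficients form a family
converging to zero: every neighbourhood of zero contains all but finitely many of them. -/
def FormalSum (X : Type v) : AddSubgroup (X → R) where
  carrier := {a | Tendsto a cofinite (𝓝 0)}
  zero_mem' := tendsto_const_nhds
  add_mem' {a b} ha hb := by
    have h : Tendsto (fun x => a x + b x) cofinite (𝓝 (0 + 0)) := Tendsto.add ha hb
    rw [add_zero] at h
    exact h
  neg_mem' {a} ha := by
    have h : Tendsto (fun x => -a x) cofinite (𝓝 (-0)) := Tendsto.neg ha
    rw [neg_zero] at h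
    exact h

variable {R}

theorem tendsto_iff {ι : Type*} {f : ι → R} : Tendsto f cofinite (𝓝 0) ↔
    ∀ I : Submodule Rᵐᵒᵖ R, IsOpen (I : Set R) → {i | f i ∉ I}.Finite := by
  rw [(IsLinearTopology.hasBasis_open_submodule (M := R) Rᵐᵒᵖ).tendsto_right_iff]
  rfl

theorem FormalSum.finite {X : Type v} (a : FormalSum R X) (I : Submodule Rᵐᵒᵖ R)
    (hI : IsOpen (I : Set R)) : {x | a.1 x ∉ I}.Finite := tendsto_iff.1 a.2 I hI

theorem summable_of_tendsto {ι : Type*} {f : ι → R} (hf : Tendsto f cofinite (𝓝 0)) :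
    Summable f := by
  have : NonarchimedeanAddGroup R := ⟨fun U hU => by
    obtain ⟨I, hI, hIU⟩ := (IsLinearTopology.hasBasis_open_submodule (M := R) Rᵐᵒᵖ).mem_iff.1 hU
    exact ⟨⟨I.toAddSubgroup, hI⟩, hIU⟩⟩
  exact NonarchimedeanAddGroup.summable_of_tendsto_cofinite_zero hf

theorem FormalSum.summable {X : Type v} (a : FormalSum R X) : Summable a.1 :=
  summable_of_tendsto a.2

theorem tsum_mem_of_isOpen (I : Submodule Rᵐᵒᵖ R) (hI : IsOpen (I : Set R)) {ι : Type*}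
    {f : ι → R} (h : ∀ i, f i ∈ I) : ∑' i, f i ∈ I :=
  _root_.tsum_mem (s := I.toAddSubgroup)
    (AddSubgroup.isClosed_of_isOpen I.toAddSubgroup hI) h

/-- Summing a null double family over one variable gives a null family. -/
theorem tendsto_tsum {ι : Type*} {κ : Type*} {F : ι × κ → R} (hF : Tendsto F cofinite (𝓝 0)) :
    Tendsto (fun k => ∑' i, F (i, k)) cofinite (𝓝 0) := by
  refine tendsto_iff.2 fun I hI => ((tendsto_iff.1 hF I hI).image Prod.snd).subset ?_
  intro k hk
  by_contra h
  refine hk (tsum_mem_of_isOpen I hI fun i => ?_)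
  by_contra h'
  exact h ⟨(i, k), h', rfl⟩

/-- If `a` is a null family and every `g x` is one, then `(x, y) ↦ aₓ · (g x)_y` is one. -/
theorem tendsto_mul {ι : Type*} {κ : Type*} {a : ι → R} (ha : Tendsto a cofinite (𝓝 0))
    {g : ι → κ → R} (hg : ∀ i, Tendsto (g i) cofinite (𝓝 0)) :
    Tendsto (fun p : ι × κ => a p.1 * g p.1 p.2) cofinite (𝓝 0) := by
  refine tendsto_iff.2 fun I hI => ?_
  have hfin := tendsto_iff.1 ha I hI
  have hi : ∀ i, {k | a i * g i k ∉ I}.Finite := fun i => by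
    have h : Tendsto (fun k => a i * g i k) cofinite (𝓝 (a i * 0)) := (hg i).const_mul (a i)
    rw [mul_zero] at h
    exact tendsto_iff.1 h I hI
  refine (hfin.biUnion fun i _ => (hi i).image (Prod.mk i)).subset ?_
  rintro ⟨i, k⟩ h
  simp only [Set.mem_iUnion]
  refine ⟨i, fun hmem => h ?_, k, h, rfl⟩
  exact I.smul_mem (MulOpposite.op (g i k)) hmem

/-! ## The monad `X ↦ R[[X]]` -/

/-- The monad unit `X → R[[X]]`, sending `x` to the formal linear combination `1 x`. -/
def point {X : Type v} (x : X) : FormalSum R X := by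
  classical
  exact ⟨Pi.single x 1, tendsto_iff.2 fun I _ => (Set.finite_singleton x).subset fun y hy => by
    by_contra h
    exact hy (by rw [Pi.single_eq_of_ne h]; exact I.zero_mem)⟩

/-- The map `R[[f]] : R[[X]] → R[[Y]]`, `∑ aₓ x ↦ ∑_y (∑_{f x = y} aₓ) y`. -/
def map {X : Type v} {Y : Type w} (f : X → Y) (a : FormalSum R X) : FormalSum R Y :=
  ⟨fun y => ∑' x : {x // f x = y}, a.1 x, tendsto_iff.2 fun I hI =>
    ((FormalSum.finite a I hI).image f).subset fun y hy => by
      by_contra h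
      refine hy (tsum_mem_of_isOpen I hI fun x => ?_)
      by_contra h'
      exact h ⟨x.1, h', x.2⟩⟩

/-- Substitution of formal linear combinations into a formal linear combination,
`∑ aₓ x ↦ ∑_y (∑_x aₓ (g x)_y) y`. -/
def bind {X : Type v} {Y : Type w} (a : FormalSum R X) (g : X → FormalSum R Y) :
    FormalSum R Y :=
  ⟨fun y => ∑' x, a.1 x * (g x).1 y, tendsto_tsum (tendsto_mul a.2 fun x => (g x).2)⟩

/-- The monad multiplication `R[[R[[X]]]] → R[[X]]` ("opening of parentheses"):
the coefficient of `∑ r_y y` at `x` is `∑_y r_y y_x`. -/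
def join {X : Type v} (r : FormalSum R (FormalSum R X)) : FormalSum R X :=
  ⟨fun x => ∑' y : FormalSum R X, r.1 y * y.1 x, tendsto_tsum (tendsto_mul r.2 fun y => y.2)⟩

theorem join_eq_bind {X : Type v} (r : FormalSum R (FormalSum R X)) : join r = bind r id := rfl

theorem point_apply_self {X : Type v} (x : X) : (point (R := R) x).1 x = 1 := by
  classical
  simp [point]

theorem point_apply_ne {X : Type v} {x y : X} (h : y ≠ x) : (point (R := R) x).1 y = 0 := by
  classical
  simp [point, h]

theorem map_eq_bind {X : Type v} {Y : Type w} (f : X → Y) (a : FormalSum R X) :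
    map f a = bind a fun x => point (f x) := by
  refine Subtype.ext (funext fun y => ?_)
  change ∑' x : {x | f x = y}, a.1 x = ∑' x, a.1 x * (point (f x)).1 y
  rw [tsum_subtype {x | f x = y} a.1]
  refine tsum_congr fun x => ?_
  by_cases h : f x = y
  · rw [Set.indicator_of_mem (by exact h), h, point_apply_self, mul_one]
  · rw [Set.indicator_of_notMem (by exact h), point_apply_ne (Ne.symm h), mul_zero]

theorem point_bind {X : Type v} {Y : Type w} (x : X) (g : X → FormalSum R Y) :
    bind (point x) g = g x := by
  refine Subtype.ext (funext fun y => ?_)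
  change ∑' x', (point x).1 x' * (g x').1 y = _
  rw [tsum_eq_single x fun x' h => by rw [point_apply_ne h, zero_mul], point_apply_self, one_mul]

theorem bind_point {X : Type v} (a : FormalSum R X) : bind a point = a := by
  refine Subtype.ext (funext fun y => ?_)
  change ∑' x', a.1 x' * (point x').1 y = _
  rw [tsum_eq_single y fun x' h => by rw [point_apply_ne h.symm, mul_zero], point_apply_self,
    mul_one]

theorem bind_bind {X : Type*} {Y : Type*} {Z : Type*} (a : FormalSum R X)
    (g : X → FormalSum R Y) (h : Y → FormalSum R Z) :
    bind (bind a g) h = bind a fun x => bind (g x) h := by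
  refine Subtype.ext (funext fun z => ?_)
  have hnull := tendsto_mul a.2 (fun x => (g x).2)
  have key : Tendsto (fun p : (X × Y) × Z => (a.1 p.1.1 * (g p.1.1).1 p.1.2) * (h p.1.2).1 p.2)
      cofinite (𝓝 0) := tendsto_mul hnull fun p => (h p.2).2
  have key2 : Tendsto (fun p : X × Y => (a.1 p.1 * (g p.1).1 p.2) * (h p.2).1 z)
      cofinite (𝓝 0) :=
    key.comp (Function.Injective.tendsto_cofinite (f := fun p : X × Y => (p, z))
      fun p q hpq => congrArg Prod.fst hpq)
  have hs : Summable (Function.uncurry fun (x : X) (y : Y) =>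
      a.1 x * (g x).1 y * (h y).1 z) := summable_of_tendsto key2
  have hy : ∀ y, Summable fun x => a.1 x * (g x).1 y := fun y => summable_of_tendsto
    (hnull.comp (Function.Injective.tendsto_cofinite (f := fun x : X => (x, y))
      fun p q hpq => congrArg Prod.fst hpq))
  have hx : ∀ x, Summable fun y => (g x).1 y * (h y).1 z := fun x => summable_of_tendsto
    ((tendsto_mul (g x).2 fun y => (h y).2).comp
      (Function.Injective.tendsto_cofinite (f := fun y : Y => (y, z))
        fun p q hpq => congrArg Prod.fst hpq))
  change ∑' y, (∑' x, a.1 x * (g x).1 y) * (h y).1 z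
    = ∑' x, a.1 x * ∑' y, (g x).1 y * (h y).1 z
  calc ∑' y, (∑' x, a.1 x * (g x).1 y) * (h y).1 z
      = ∑' y, ∑' x, a.1 x * (g x).1 y * (h y).1 z :=
        tsum_congr fun y => ((hy y).tsum_mul_right _).symm
    _ = ∑' x, ∑' y, a.1 x * (g x).1 y * (h y).1 z := hs.tsum_comm
    _ = _ := tsum_congr fun x => by
        rw [← (hx x).tsum_mul_left]
        simp only [mul_assoc]

theorem bind_add {X : Type v} {Y : Type w} (a b : FormalSum R X) (g : X → FormalSum R Y) :
    bind (a + b) g = bind a g + bind b g := by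
  refine Subtype.ext (funext fun y => ?_)
  have hs : ∀ c : FormalSum R X, Summable fun x => c.1 x * (g x).1 y := fun c =>
    summable_of_tendsto ((tendsto_mul c.2 fun x => (g x).2).comp
      (Function.Injective.tendsto_cofinite (f := fun x : X => (x, y))
        fun p q hpq => congrArg Prod.fst hpq))
  change ∑' x, (a.1 x + b.1 x) * (g x).1 y
    = ∑' x, a.1 x * (g x).1 y + ∑' x, b.1 x * (g x).1 y
  rw [← (hs a).tsum_add (hs b)]
  simp only [add_mul]

theorem bind_sub_right {X : Type v} {Y : Type w} (a : FormalSum R X) (g h : X → FormalSum R Y) :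
    bind a (fun x => g x - h x) = bind a g - bind a h := by
  refine Subtype.ext (funext fun y => ?_)
  have hs : ∀ g : X → FormalSum R Y, Summable fun x => a.1 x * (g x).1 y := fun g =>
    summable_of_tendsto ((tendsto_mul a.2 fun x => (g x).2).comp
      (Function.Injective.tendsto_cofinite (f := fun x : X => (x, y))
        fun p q hpq => congrArg Prod.fst hpq))
  change ∑' x, a.1 x * ((g x).1 y - (h x).1 y)
    = ∑' x, a.1 x * (g x).1 y - ∑' x, a.1 x * (h x).1 y
  rw [← (hs g).tsum_sub (hs h)]
  simp only [mul_sub]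

theorem map_id {X : Type v} (a : FormalSum R X) : map id a = a := by
  rw [map_eq_bind]
  exact bind_point a

theorem map_map {X : Type*} {Y : Type*} {Z : Type*} (g : Y → Z) (f : X → Y)
    (a : FormalSum R X) : map g (map f a) = map (g ∘ f) a := by
  simp only [map_eq_bind, bind_bind, point_bind, Function.comp_apply]

theorem map_point {X : Type v} {Y : Type w} (f : X → Y) (x : X) :
    map f (point (R := R) x) = point (f x) := by
  rw [map_eq_bind, point_bind]

theorem map_add {X : Type v} {Y : Type w} (f : X → Y) (a b : FormalSum R X) :
    map f (a + b) = map f a + map f b := by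
  simp only [map_eq_bind, bind_add]

theorem map_neg {X : Type v} {Y : Type w} (f : X → Y) (a : FormalSum R X) :
    map f (-a) = -map f a :=
  _root_.map_neg (AddMonoidHom.mk' (map (R := R) f) (map_add f)) a

theorem map_zero {X : Type v} {Y : Type w} (f : X → Y) :
    map f (0 : FormalSum R X) = 0 :=
  _root_.map_zero (AddMonoidHom.mk' (map (R := R) f) (map_add f))

theorem map_bind {X : Type*} {Y : Type*} {Z : Type*} (f : Y → Z) (a : FormalSum R X)
    (g : X → FormalSum R Y) : map f (bind a g) = bind a fun x => map f (g x) := by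
  simp only [map_eq_bind, bind_bind]

theorem join_map {X : Type v} {Y : Type w} (g : X → FormalSum R Y) (a : FormalSum R X) :
    join (map g a) = bind a g := by
  simp only [join_eq_bind, map_eq_bind, bind_bind, point_bind, id]

theorem join_point {X : Type v} (a : FormalSum R X) : join (point a) = a := by
  rw [join_eq_bind, point_bind, id]

theorem join_add {X : Type v} (r s : FormalSum R (FormalSum R X)) :
    join (r + s) = join r + join s := by
  simp only [join_eq_bind, bind_add]

theorem join_join {X : Type v} (r : FormalSum R (FormalSum R (FormalSum R X))) :
    join (join r) = join (map join r) := by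
  rw [join_map, join_eq_bind (join r), join_eq_bind r, bind_bind]
  rfl

end FormalSums

/-! ## Contramodules -/

section Contramodules

variable (R : Type u) [Ring R] [UniformSpace R] [IsUniformAddGroup R] [IsTopologicalRing R]
  [CompleteSpace R] [T2Space R] [IsLinearTopology Rᵐᵒᵖ R]

/-- A left `R`-contramodule: an algebra over the monad `X ↦ R[[X]]` on the category of sets,
that is, a set with a contraaction map satisfying contraunitality and contraassociativity. -/
structure Contramodule where
  /-- the underlying set -/
  carrier : Type u
  /-- the contraaction map -/
  contra : FormalSum R carrier → carrier
  contra_point : ∀ c, contra (point c) = c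
  contra_join : ∀ r : FormalSum R (FormalSum R carrier),
    contra (join r) = contra (map contra r)

instance : CoeSort (Contramodule R) (Type u) := ⟨Contramodule.carrier⟩

variable {R}

/-- Morphisms of contramodules: maps commuting with the contraaction. -/
@[ext]
structure Hom (C D : Contramodule R) where
  /-- the underlying map -/
  toFun : C → D
  map_contra : ∀ r : FormalSum R C, toFun (C.contra r) = D.contra (map toFun r)

/-- The category `R-contra` of left `R`-contramodules. -/
instance : Category (Contramodule R) where
  Hom := Hom
  id C := ⟨id, fun r => by rw [map_id, id]⟩
  comp f g := ⟨g.toFun ∘ f.toFun, fun r => by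
    rw [Function.comp_apply, f.map_contra, g.map_contra, map_map]⟩

@[ext]
theorem hom_ext {C D : Contramodule R} {f g : C ⟶ D} (h : ∀ c, f.toFun c = g.toFun c) : f = g :=
  Hom.ext (funext h)

theorem comp_toFun {C D E : Contramodule R} (f : C ⟶ D) (g : D ⟶ E) (c : C) :
    (f ≫ g).toFun c = g.toFun (f.toFun c) := rfl

theorem id_toFun {C : Contramodule R} (c : C) : Hom.toFun (𝟙 C) c = c := rfl

namespace Contramodule

variable (C : Contramodule R)

theorem contra_add (a b : FormalSum R C) :
    C.contra (a + b) = C.contra (point (C.contra a) + point (C.contra b)) := by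
  have h := C.contra_join (point a + point b)
  rwa [join_add, join_point, join_point, map_add, map_point, map_point] at h

instance : Add C := ⟨fun c d => C.contra (point c + point d)⟩

instance : Zero C := ⟨C.contra 0⟩

instance : Neg C := ⟨fun c => C.contra (-point c)⟩

/-- The underlying abelian group of a contramodule: sums are given by the contraaction on
finite formal linear combinations, `c + d = π(1 c + 1 d)`, `0 = π(0)` and `-c = π((-1) c)`. -/
instance : AddCommGroup C where
  add_assoc a b c := by
    change C.contra (point (C.contra (point a + point b)) + point c)
      = C.contra (point a + point (C.contra (point b + point c)))
    have h1 := C.contra_add (point a + point b) (point c)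
    have h2 := C.contra_add (point a) (point b + point c)
    rw [C.contra_point] at h1 h2
    rw [← h1, ← h2, add_assoc]
  zero_add a := by
    change C.contra (point (C.contra 0) + point a) = a
    have h := C.contra_add 0 (point a)
    rw [C.contra_point] at h
    rw [← h, zero_add, C.contra_point]
  add_zero a := by
    change C.contra (point a + point (C.contra 0)) = a
    have h := C.contra_add (point a) 0
    rw [C.contra_point] at h
    rw [← h, add_zero, C.contra_point]
  neg_add_cancel a := by
    change C.contra (point (C.contra (-point a)) + point a) = C.contra 0
    have h := C.contra_add (-point a) (point a)
    rw [C.contra_point] at h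
    rw [← h, neg_add_cancel]
  add_comm a b := by
    change C.contra (point a + point b) = C.contra (point b + point a)
    rw [add_comm]
  nsmul := nsmulRec
  zsmul := zsmulRec

theorem add_def (c d : C) : c + d = C.contra (point c + point d) := rfl

/-- The contraaction as a group homomorphism. -/
def contraHom : FormalSum R C →+ C := AddMonoidHom.mk' C.contra C.contra_add

theorem contra_sub (a b : FormalSum R C) : C.contra (a - b) = C.contra a - C.contra b :=
  _root_.map_sub C.contraHom a b

theorem contra_zero : C.contra 0 = 0 := rfl

variable {C}

theorem contra_map_sub {X : Type u} (g h : X → C) (a : FormalSum R X) :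
    C.contra (map (fun x => g x - h x) a) = C.contra (map g a) - C.contra (map h a) := by
  have h1 : (fun x => g x - h x) = C.contra ∘ fun x => point (g x) - point (h x) := by
    funext x
    rw [Function.comp_apply, contra_sub, C.contra_point, C.contra_point]
  rw [h1, ← map_map, ← C.contra_join, join_map, bind_sub_right, ← map_eq_bind, ← map_eq_bind,
    contra_sub]

theorem contra_map_zero {X : Type u} (a : FormalSum R X) :
    C.contra (map (fun _ => (0 : C)) a) = 0 := by
  have h := contra_map_sub (C := C) (fun _ : X => (0 : C)) (fun _ => 0) a
  simpa only [sub_self] using h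

end Contramodule

theorem Hom.map_add {C D : Contramodule R} (f : Hom C D) (a b : C) :
    f.toFun (a + b) = f.toFun a + f.toFun b := by
  rw [Contramodule.add_def, f.map_contra, Contra.map_add, map_point, map_point]
  rfl

/-- The additive map underlying a contramodule morphism. -/
def Hom.toAddHom {C D : Contramodule R} (f : Hom C D) : C →+ D :=
  AddMonoidHom.mk' f.toFun f.map_add

/-- The free contramodule `R[[X]]`, with the monad multiplication as contraaction. -/
def free (R : Type u) [Ring R] [UniformSpace R] [IsUniformAddGroup R] [IsTopologicalRing R]
    [CompleteSpace R] [T2Space R] [IsLinearTopology Rᵐᵒᵖ R] (X : Type u) : Contramodule R where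
  carrier := FormalSum R X
  contra := join
  contra_point := join_point
  contra_join := join_join

/-- The morphism `R[[X]] ⟶ C` extending a map of sets `X → C`. -/
def freeLift {X : Type u} {C : Contramodule R} (g : X → C) : free R X ⟶ C where
  toFun a := C.contra (map g a)
  map_contra r := by
    have key : ∀ r : FormalSum R (FormalSum R X),
        C.contra (map g (join r)) = C.contra (map (C.contra ∘ map g) r) := fun r => by
      rw [← map_map, ← C.contra_join, join_map, join_eq_bind, map_bind]
      rfl
    exact key r

theorem freeLift_apply {X : Type u} {C : Contramodule R} (g : X → C) (a : FormalSum R X) :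
    (freeLift g).toFun a = C.contra (map g a) := rfl

theorem freeLift_point {X : Type u} {C : Contramodule R} (g : X → C) (x : X) :
    (freeLift g).toFun (point x) = g x :=
  (freeLift_apply g (point x)).trans (by rw [map_point, C.contra_point])

theorem free_hom_apply {X : Type u} {C : Contramodule R} (f : free R X ⟶ C)
    (a : FormalSum R X) : f.toFun a = C.contra (map (fun x => f.toFun (point x)) a) := by
  have h : a = join (map (point : X → FormalSum R X) a) := by rw [join_map, bind_point]
  have h1 : f.toFun a = f.toFun (join (map (point : X → FormalSum R X) a)) := congrArg f.toFun h
  have h2 := f.map_contra (map (point : X → FormalSum R X) a)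
  have h3 : map f.toFun (map (point : X → FormalSum R X) a) = map (fun x => f.toFun (point x)) a :=
    map_map (X := X) (Y := FormalSum R X) f.toFun point a
  exact h1.trans (h2.trans (congrArg C.contra h3))

/-- Contramodule morphisms that are epimorphisms are surjective: otherwise the projection to the
quotient contramodule by the image would differ from the zero map. -/
theorem surjective_of_epi {A B : Contramodule R} (f : A ⟶ B) [Epi f] :
    Function.Surjective f.toFun := by
  let q : B → B ⧸ f.toAddHom.range := fun b => (b : B ⧸ f.toAddHom.range)
  let t : B ⧸ f.toAddHom.range → B := Quotient.out
  have hqt : ∀ x, q (t x) = x := fun x => Quotient.out_eq x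
  have key : ∀ r : FormalSum R B, q (B.contra (map (t ∘ q) r)) = q (B.contra r) := by
    intro r
    have hmem : ∀ b, ∃ a, f.toFun a = b - t (q b) := fun b => by
      have h : q (t (q b)) = q b := hqt (q b)
      obtain ⟨a, ha⟩ := QuotientAddGroup.eq.1 h
      exact ⟨a, by rw [show f.toFun a = _ from ha, neg_add_eq_sub]⟩
    choose s hs using hmem
    refine QuotientAddGroup.eq.2 ⟨A.contra (map s r), ?_⟩
    change f.toFun (A.contra (map s r)) = _
    rw [neg_add_eq_sub, f.map_contra, map_map]
    have h := Contramodule.contra_map_sub (C := B) id (t ∘ q) r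
    rw [map_id] at h
    rw [← h]
    congr 2
    funext b
    exact hs b
  let Q : Contramodule R :=
    { carrier := B ⧸ f.toAddHom.range
      contra := fun s => q (B.contra (map t s))
      contra_point := fun x => by rw [map_point, B.contra_point, hqt]
      contra_join := fun r => by
        have h1 : B.contra (map t (join r)) = B.contra (map (fun s => B.contra (map t s)) r) := by
          rw [join_eq_bind, map_bind]
          change B.contra (bind r (map t)) = _
          rw [← join_map, B.contra_join, map_map]
          rfl
        rw [h1, ← key, map_map, map_map]
        rfl }
  let π : B ⟶ Q := ⟨q, fun r => by
    change q (B.contra r) = q (B.contra (map t (map q r)))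
    rw [map_map, key]⟩
  let z : B ⟶ Q := ⟨fun _ => q 0, fun r => by
    change q 0 = q (B.contra (map t (map (fun _ => q 0) r)))
    rw [map_map, show t ∘ (fun _ : B => q 0) = (t ∘ q) ∘ (fun _ => (0 : B)) from rfl, ← map_map,
      key, Contramodule.contra_map_zero]⟩
  have hπ : π = z := by
    rw [← cancel_epi f]
    refine hom_ext fun a => ?_
    change q (f.toFun a) = q 0
    exact QuotientAddGroup.eq.2 ⟨-a, by
      rw [_root_.map_neg, add_zero]; rfl⟩
  intro b
  have h : q 0 = q b := (congrArg (fun g : B ⟶ Q => g.toFun b) hπ).symm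
  obtain ⟨a, ha⟩ := QuotientAddGroup.eq.1 h
  exact ⟨a, by rw [show f.toFun a = _ from ha, neg_zero, zero_add]⟩

instance free_projective (X : Type u) : Projective (free R X) where
  factors {E Y} f e _ := by
    have hsurj := surjective_of_epi e
    choose s hs using hsurj
    let g : X → Y := fun x => f.toFun (point x)
    have key : ∀ a : FormalSum R X, e.toFun (E.contra (map (s ∘ g) a)) = Y.contra (map g a) :=
      fun a => by
        rw [e.map_contra, map_map, ← Function.comp_assoc,
          show e.toFun ∘ s = id from funext hs, Function.id_comp]
    exact ⟨freeLift (s ∘ g), hom_ext fun a => (key a).trans (free_hom_apply f a).symm⟩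

/-! ## Projective resolutions -/

/-- A projective resolution `⋯ ⟶ P₂ ⟶ P₁ ⟶ P₀ ⟶ C ⟶ 0`: an exact complex in the category of
contramodules with projective `Pᵢ` (exactness is exactness on underlying abelian groups). -/
structure Resolution (C : Contramodule R) where
  /-- the terms -/
  X : ℕ → Contramodule R
  /-- the differentials -/
  d : ∀ n, X (n + 1) ⟶ X n
  /-- the augmentation -/
  aug : X 0 ⟶ C
  projective : ∀ n, Projective (X n)
  aug_surjective : Function.Surjective aug.toFun
  exact_zero : ∀ x, aug.toFun x = 0 ↔ ∃ y, (d 0).toFun y = x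
  exact_succ : ∀ n x, (d n).toFun x = 0 ↔ ∃ y, (d (n + 1)).toFun y = x

/-- The covering `R[[ker f]] ⟶ B` of the kernel of a morphism `f : B ⟶ D`. -/
def kernelCover {B D : Contramodule R} (f : B ⟶ D) : free R {b : B // f.toFun b = 0} ⟶ B :=
  freeLift Subtype.val

theorem kernelCover_exact {B D : Contramodule R} (f : B ⟶ D) (b : B) :
    f.toFun b = 0 ↔ ∃ y, (kernelCover f).toFun y = b := by
  constructor
  · intro h
    exact ⟨point (⟨b, h⟩ : {b : B // f.toFun b = 0}), freeLift_point _ _⟩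
  · rintro ⟨y, rfl⟩
    have h : f.toFun ∘ (Subtype.val : {b : B // f.toFun b = 0} → B) = fun _ => 0 :=
      funext fun b => b.2
    have key : ∀ a : FormalSum R {b : B // f.toFun b = 0},
        f.toFun (B.contra (map Subtype.val a)) = 0 := fun a => by
      rw [f.map_contra, map_map, h, Contramodule.contra_map_zero]
    exact key y

/-- The stages of the standard free resolution: the `n`-th stage is the morphism from the `n`-th
free term to the preceding term (to `C` if `n = 0`). -/
def standardStage (C : Contramodule R) : ℕ → Σ X Y : Contramodule R, X ⟶ Y
  | 0 => ⟨free R C, C, freeLift id⟩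
  | n + 1 => ⟨_, _, kernelCover (standardStage C n).2.2⟩

/-- The standard free resolution: `P₀ = R[[C]]` with the contraaction `P₀ ⟶ C`, and each `Pₙ₊₁` is
the free contramodule on the set of elements of the kernel of the preceding map. -/
def standardResolution (C : Contramodule R) : Resolution C where
  X n := (standardStage C n).1
  d n := kernelCover (standardStage C n).2.2
  aug := freeLift id
  projective n := by
    cases n
    · exact free_projective _
    · exact free_projective _
  aug_surjective c := ⟨point c, freeLift_point _ _⟩
  exact_zero x := kernelCover_exact (freeLift (C := C) id) x
  exact_succ n x := kernelCover_exact (kernelCover (standardStage C n).2.2) x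

/-! ## Contratensor products with discrete right modules -/

/-- A right `R`-module (a module over `Rᵐᵒᵖ`) is discrete if the annihilator of each of its
elements is open in `R`. -/
class IsDiscreteModule (R : Type u) [Ring R] [TopologicalSpace R] (N : Type v) [AddCommGroup N]
    [Module Rᵐᵒᵖ N] : Prop where
  isOpen_annihilator : ∀ n : N, IsOpen {r : R | MulOpposite.op r • n = 0}

section Contratensor

variable (N : Type u) [AddCommGroup N] [Module Rᵐᵒᵖ N]

theorem finite_support [IsDiscreteModule R N] {X : Type v} (n : N) (a : FormalSum R X) :
    {x | MulOpposite.op (a.1 x) • n ≠ 0}.Finite := by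
  have h : ∀ᶠ x in cofinite, a.1 x ∈ {r : R | MulOpposite.op r • n = 0} :=
    a.2 ((IsDiscreteModule.isOpen_annihilator n).mem_nhds (by simp))
  exact h

/-- `n · ∑ᵢ rᵢ = ∑ᵢ n · rᵢ` for null families in `R` and elements of discrete modules. -/
theorem op_tsum_smul [IsDiscreteModule R N] {ι : Type v} (n : N) (a : ι → R)
    (ha : Tendsto a cofinite (𝓝 0)) :
    MulOpposite.op (∑' i, a i) • n = ∑ᶠ i, MulOpposite.op (a i) • n := by
  have hfin : (Function.support fun i => MulOpposite.op (a i) • n).Finite :=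
    finite_support N n (⟨a, ha⟩ : FormalSum R ι)
  have hs := (summable_of_tendsto ha).hasSum
  have hU : {r : R | MulOpposite.op (r - ∑' i, a i) • n = 0} ∈ 𝓝 (∑' i, a i) := by
    have hc : Continuous fun r : R => r - ∑' i, a i := continuous_id.sub continuous_const
    exact ((IsDiscreteModule.isOpen_annihilator n).preimage hc).mem_nhds (by simp)
  obtain ⟨s, hs'⟩ := ((hs.eventually hU).and
    (eventually_ge_atTop hfin.toFinset)).exists
  obtain ⟨h1, h2⟩ := hs'
  rw [finsum_eq_sum_of_support_subset (s := s) _ fun i hi => h2 (hfin.mem_toFinset.2 hi)]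
  have h3 : MulOpposite.op (∑ i ∈ s, a i - ∑' i, a i) • n = 0 := h1
  rw [MulOpposite.op_sub, sub_smul, sub_eq_zero] at h3
  rw [← h3, Finset.op_sum, Finset.sum_smul]

/-- The image in `N ⊗ C` of the difference of the two maps `N ⊗ R[[C]] ⇉ N ⊗ C`, namely
`n ⊗ ∑ r_c c ↦ n ⊗ π(∑ r_c c)` and `n ⊗ ∑ r_c c ↦ ∑ (n r_c) ⊗ c` (a finite sum, as `N` is
discrete). -/
def contratensorRel (C : Contramodule R) : AddSubgroup (N ⊗[ℤ] C) :=
  AddSubgroup.closure {t | ∃ (n : N) (r : FormalSum R C),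
    t = n ⊗ₜ[ℤ] C.contra r - ∑ᶠ c : C, (MulOpposite.op (r.1 c) • n) ⊗ₜ[ℤ] c}

/-- The contratensor product `N ⊙ C` of a discrete right module and a left contramodule: the
cokernel of the difference of the two maps `N ⊗ R[[C]] ⇉ N ⊗ C`. -/
def Contratensor (C : Contramodule R) : Type u := (N ⊗[ℤ] C) ⧸ contratensorRel N C

instance (C : Contramodule R) : AddCommGroup (Contratensor N C) :=
  inferInstanceAs (AddCommGroup ((N ⊗[ℤ] C) ⧸ contratensorRel N C))

/-- The map `N ⊗ C → N ⊗ D` induced by a contramodule morphism. -/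
def tensorMap {C D : Contramodule R} (f : C ⟶ D) : N ⊗[ℤ] C →+ N ⊗[ℤ] D :=
  (TensorProduct.map LinearMap.id f.toAddHom.toIntLinearMap).toAddMonoidHom

theorem tensorMap_tmul {C D : Contramodule R} (f : C ⟶ D) (n : N) (c : C) :
    tensorMap N f (n ⊗ₜ c) = n ⊗ₜ f.toFun c := rfl

theorem tensorMap_rel [IsDiscreteModule R N] {C D : Contramodule R} (f : C ⟶ D) :
    contratensorRel N C ≤ (contratensorRel N D).comap (tensorMap N f) := by
  refine (AddSubgroup.closure_le _).2 ?_
  rintro _ ⟨n, r, rfl⟩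
  refine AddSubgroup.subset_closure ⟨n, map f.toFun r, ?_⟩
  have hfin : (Function.support fun c : C => MulOpposite.op (r.1 c) • n).Finite :=
    finite_support N n r
  have hfin' : (Function.support fun c : C =>
      (MulOpposite.op (r.1 c) • n) ⊗ₜ[ℤ] c).Finite := hfin.subset fun c hc hc' => hc (by
    change (MulOpposite.op (r.1 c) • n) = 0 at hc'
    simp only [hc', TensorProduct.zero_tmul])
  rw [map_sub, tensorMap_tmul, f.map_contra, (tensorMap N f).map_finsum hfin']
  congr 1
  simp only [tensorMap_tmul]
  have hnull : ∀ d : D, Tendsto (fun c : {c // f.toFun c = d} => r.1 c.1) cofinite (𝓝 0) :=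
    fun d => r.2.comp Subtype.val_injective.tendsto_cofinite
  classical
  have hcoeff : ∀ d : D, (MulOpposite.op ((map f.toFun r).1 d) • n) ⊗ₜ[ℤ] d
      = ∑ c ∈ hfin.toFinset, if f.toFun c = d then (MulOpposite.op (r.1 c) • n) ⊗ₜ[ℤ] d else 0 := by
    intro d
    have h1 : MulOpposite.op ((map f.toFun r).1 d) • n
        = ∑ᶠ c : {c // f.toFun c = d}, MulOpposite.op (r.1 c.1) • n :=
      op_tsum_smul N n _ (hnull d)
    have h2 : (∑ᶠ c : {c // f.toFun c = d}, MulOpposite.op (r.1 c.1) • n)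
        = ∑ c ∈ hfin.toFinset, if f.toFun c = d then MulOpposite.op (r.1 c) • n else 0 := by
      rw [finsum_subtype_eq_finsum_cond (f := fun c => MulOpposite.op (r.1 c) • n)
        (fun c => f.toFun c = d)]
      simp only [finsum_eq_if]
      refine finsum_eq_sum_of_support_subset _ fun c hc => ?_
      rw [Finset.mem_coe, hfin.mem_toFinset]
      intro h0
      exact hc (by simp only [h0, ite_self])
    rw [h1, h2, TensorProduct.sum_tmul]
    refine Finset.sum_congr rfl fun c _ => ?_
    split_ifs
    · rfl
    · exact TensorProduct.zero_tmul _ _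
  simp only [hcoeff]
  rw [finsum_sum_comm]
  · rw [finsum_eq_sum_of_support_subset (s := hfin.toFinset)]
    · refine Finset.sum_congr rfl fun c _ => ?_
      rw [finsum_eq_single _ (f.toFun c) fun d hd => if_neg (Ne.symm hd), if_pos rfl]
    · intro c hc
      rw [Finset.mem_coe, hfin.mem_toFinset]
      intro h0
      exact hc (by simp only [h0, TensorProduct.zero_tmul])
  · intro c _
    refine (Set.finite_singleton (f.toFun c)).subset fun d hd => ?_
    by_contra h
    exact hd (if_neg (Ne.symm h))

/-- The functoriality `N ⊙ f : N ⊙ C → N ⊙ D` of the contratensor product. -/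
def Contratensor.map [IsDiscreteModule R N] {C D : Contramodule R} (f : C ⟶ D) :
    Contratensor N C →+ Contratensor N D :=
  QuotientAddGroup.map _ _ (tensorMap N f) (tensorMap_rel N f)

/-! ## The derived functors of the contratensor product -/

variable [IsDiscreteModule R N]

/-- The cycles in degree `i` of the complex `N ⊙ P`. -/
def Resolution.cycles {C : Contramodule R} (P : Resolution C) :
    (i : ℕ) → AddSubgroup (Contratensor N (P.X i))
  | 0 => ⊤
  | i + 1 => (Contratensor.map N (P.d i)).ker

/-- The homology `H_i(N ⊙ P)`. -/
def Resolution.homology {C : Contramodule R} (P : Resolution C) (i : ℕ) : Type u :=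
  P.cycles N i ⧸ (Contratensor.map N (P.d i)).range.addSubgroupOf (P.cycles N i)

instance {C : Contramodule R} (P : Resolution C) (i : ℕ) : AddCommGroup (P.homology N i) :=
  inferInstanceAs (AddCommGroup
    (P.cycles N i ⧸ (Contratensor.map N (P.d i)).range.addSubgroupOf (P.cycles N i)))

/-- The left derived functor `Ctrtor_i(N, C) = H_i(N ⊙ P)` of the contratensor product in its
contramodule argument, computed by the standard free resolution `P` of `C`. -/
def Ctrtor (C : Contramodule R) (i : ℕ) : Type u := (standardResolution C).homology N i

instance (C : Contramodule R) (i : ℕ) : AddCommGroup (Ctrtor N C i) :=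
  inferInstanceAs (AddCommGroup ((standardResolution C).homology N i))

end Contratensor

/-- A contramodule `F` is `1`-strictly flat if `Ctrtor₁(N, F) = 0` for all discrete right
modules `N`. -/
def IsOneStrictlyFlat (F : Contramodule R) : Prop :=
  ∀ (N : Type u) [AddCommGroup N] [Module Rᵐᵒᵖ N] [IsDiscreteModule R N],
    Subsingleton (Ctrtor N F 1)

end Contramodules

/-! ## Projective covers -/

/-- A projective cover of `F`: an epimorphism `p : P ⟶ F` from a projective object such that every
endomorphism `e` of `P` with `p e = p` is an automorphism. -/
structure IsProjectiveCover {A : Type u} [Category.{v} A] {P F : A} (p : P ⟶ F) : Prop where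
  projective : Projective P
  epi : Epi p
  isIso_of_comp_eq : ∀ e : P ⟶ P, e ≫ p = p → IsIso e

end

end Contra

/-!
For an open right ideal `J`, the contratensor product `R/J ⊙ C` is `C / J C`.  Hence, if `F` is
`1`-strictly flat and `K` is the kernel of `R[[F]] → F`, the vanishing of `Ctrtor₁(R/J, F)` says
that `K ∩ J R[[F]] = J K`.  Given `a ∈ K` and an open right ideal `I`, apply this to the right ideal
`J` generated by `I` and by the finitely many coefficients of `a` outside `I`: as in Villamayor's
criterion for flat modules, it yields an endomorphism `ψ` of `R[[F]]` over `F` with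
`ψ(a) ∈ I R[[F]]`.

Now lift `p : P ⟶ F` and `R[[F]] ⟶ F` along each other to `u : P ⟶ R[[F]]` and `v : R[[F]] ⟶ P`.
If `p(k) = 0`, take `ψ` as above for `a = u(k)`.  The endomorphism of `P` given by `u`, `ψ`, `v` in
this order lies over `F`, so it is an automorphism; therefore `u` factors through `u` followed by
`ψ`, and `u(k) ∈ I R[[F]]`.  As `I` is arbitrary, `u(k) = 0`, and `k = 0` because `v u` is an
automorphism too.
-/

namespace Contra

noncomputable section

theorem eq_zero_of_forall_mem_isOpen {A : Type u} {M : Type v} [Ring A] [AddCommGroup M]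
    [Module A M] [TopologicalSpace M] [ContinuousAdd M] [T1Space M] [IsLinearTopology A M] {m : M}
    (h : ∀ I : Submodule A M, IsOpen (I : Set M) → m ∈ I) : m = 0 := by
  have hm : m ∈ (𝓝 (0 : M)).ker := by
    rw [(IsLinearTopology.hasBasis_open_submodule (M := M) A).ker]
    exact Set.mem_iInter₂.2 h
  rwa [ker_nhds] at hm

theorem exists_sub_sum_mul_mem_of_mem_sup_span {R : Type u} [Ring R] {I : Submodule Rᵐᵒᵖ R}
    {X : Type v} {a : X → R} {T : Finset X} {j : R}
    (hj : j ∈ I ⊔ Submodule.span Rᵐᵒᵖ (a '' T)) :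
    ∃ s : X → R, j - ∑ x ∈ T, a x * s x ∈ I := by
  obtain ⟨i, hi, b, hb, rfl⟩ := Submodule.mem_sup.1 hj
  obtain ⟨s, rfl⟩ := (Submodule.mem_span_image_finset_iff_exists_fun' Rᵐᵒᵖ).1 hb
  exact ⟨fun x => (s x).unop, (add_sub_cancel_right i _).symm ▸ hi⟩

theorem isDiscreteModule_quotient_iff {R : Type u} [Ring R] [TopologicalSpace R]
    [ContinuousMul R] {J : Submodule Rᵐᵒᵖ R} :
    IsDiscreteModule R (R ⧸ J) ↔ IsOpen (J : Set R) := by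
  have hann : ∀ s : R, {r : R | MulOpposite.op r • (Submodule.Quotient.mk s : R ⧸ J) = 0}
      = (s * ·) ⁻¹' (J : Set R) := fun s => Set.ext fun r => by
    rw [Set.mem_ofPred_eq, ← Submodule.Quotient.mk_smul, Submodule.Quotient.mk_eq_zero]
    rfl
  refine ⟨fun h => ?_, fun hJ => ⟨fun n => ?_⟩⟩
  · simpa only [hann, one_mul, Set.preimage_id'] using
      h.isOpen_annihilator (Submodule.Quotient.mk 1)
  · obtain ⟨s, rfl⟩ := Submodule.Quotient.mk_surjective J n
    exact hann s ▸ hJ.preimage (continuous_const_mul s)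

namespace FormalSum

variable {R : Type u} [Ring R] [UniformSpace R] [IsTopologicalRing R]

instance {X : Type v} : SMul R (FormalSum R X) where
  smul r a := ⟨fun x => r * a.1 x, by
    change Tendsto (fun x => r * a.1 x) cofinite (𝓝 0)
    simpa only [mul_zero] using Tendsto.const_mul r a.2⟩

instance {X : Type v} : Module R (FormalSum R X) :=
  Function.Injective.module R (FormalSum R X).subtype Subtype.val_injective fun _ _ => rfl

theorem smul_apply {X : Type v} (r : R) (a : FormalSum R X) (x : X) : (r • a).1 x = r * a.1 x :=
  rfl

/-- The formal linear combinations of elements of `S` with coefficients in the right ideal `J`. -/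
def coeffIn (J : Submodule Rᵐᵒᵖ R) {X : Type v} (S : Set X) : AddSubgroup (FormalSum R X) where
  carrier := {a | (∀ x, a.1 x ∈ J) ∧ Function.support a.1 ⊆ S}
  zero_mem' := ⟨fun _ => J.zero_mem, fun _ hx => absurd rfl hx⟩
  add_mem' ha hb := ⟨fun x => J.add_mem (ha.1 x) (hb.1 x),
    (Function.support_add _ _).trans (Set.union_subset ha.2 hb.2)⟩
  neg_mem' ha := ⟨fun x => J.neg_mem (ha.1 x), (Function.support_neg _).subset.trans ha.2⟩

theorem mem_coeffIn {J : Submodule Rᵐᵒᵖ R} {X : Type v} {S : Set X} {a : FormalSum R X} :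
    a ∈ coeffIn J S ↔ (∀ x, a.1 x ∈ J) ∧ Function.support a.1 ⊆ S :=
  Iff.rfl

theorem mem_coeffIn_univ {J : Submodule Rᵐᵒᵖ R} {X : Type v} {a : FormalSum R X} :
    a ∈ coeffIn J Set.univ ↔ ∀ x, a.1 x ∈ J := by
  rw [mem_coeffIn, and_iff_left (Set.subset_univ _)]

end FormalSum

section

variable {R : Type u} [Ring R] [UniformSpace R] [IsUniformAddGroup R] [IsTopologicalRing R]
  [CompleteSpace R] [T2Space R] [IsLinearTopology Rᵐᵒᵖ R]

namespace FormalSum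

variable {X : Type v} {Y : Type w} {J : Submodule Rᵐᵒᵖ R}

theorem summable_mul (a : FormalSum R X) (g : X → FormalSum R Y) (y : Y) :
    Summable fun x => a.1 x * (g x).1 y :=
  summable_of_tendsto ((tendsto_mul a.2 fun x => (g x).2).comp
    (Prod.mk_left_injective y).tendsto_cofinite)

theorem bind_smul (r : R) (a : FormalSum R X) (g : X → FormalSum R Y) :
    bind (r • a) g = r • bind a g := by
  refine Subtype.ext (funext fun y => ?_)
  change ∑' x, r * a.1 x * (g x).1 y = r * ∑' x, a.1 x * (g x).1 y
  simp only [mul_assoc, (summable_mul a g y).tsum_mul_left]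

theorem map_smul (f : X → Y) (r : R) (a : FormalSum R X) : map f (r • a) = r • map f a := by
  simp only [map_eq_bind, bind_smul]

theorem map_mem_coeffIn (hJ : IsOpen (J : Set R)) {S : Set X} {T : Set Y} {f : X → Y}
    (hf : Set.MapsTo f S T) {a : FormalSum R X} (ha : a ∈ coeffIn J S) :
    map f a ∈ coeffIn J T := by
  refine ⟨fun y => tsum_mem_of_isOpen J hJ fun x => ha.1 x.1, fun y hy => ?_⟩
  by_contra hyT
  have hzero : ∀ x : {x // f x = y}, a.1 x = 0 := fun x => by
    by_contra hx
    exact hyT (x.2 ▸ hf (ha.2 hx))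
  exact hy ((tsum_congr hzero).trans tsum_zero)

theorem join_apply_mem (hJ : IsOpen (J : Set R)) {b : FormalSum R (FormalSum R X)}
    (hb : ∀ y, b.1 y ∈ J) (x : X) : (join b).1 x ∈ J :=
  tsum_mem_of_isOpen J hJ fun y => J.smul_mem (MulOpposite.op (y.1 x)) (hb y)

theorem smul_point_apply [DecidableEq X] (r : R) (x y : X) :
    (r • point x : FormalSum R X).1 y = if x = y then r else 0 := by
  split_ifs with h
  · rw [smul_apply, h, point_apply_self, mul_one]
  · rw [smul_apply, point_apply_ne (Ne.symm h), mul_zero]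

theorem sub_sum_smul_point_mem_coeffIn {a : FormalSum R X} {T : Finset X}
    (hT : ∀ x ∉ T, a.1 x ∈ J) : a - ∑ x ∈ T, a.1 x • point x ∈ coeffIn J Set.univ := by
  classical
  refine mem_coeffIn_univ.2 fun y => ?_
  have hsum : (∑ x ∈ T, a.1 x • point x : FormalSum R X).1 y = if y ∈ T then a.1 y else 0 := by
    simp only [AddSubgroup.val_finsetSum, Finset.sum_apply, smul_point_apply, Finset.sum_ite_eq']
  rw [AddSubgroup.coe_sub, Pi.sub_apply, hsum]
  split_ifs with hy
  · rw [sub_self]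
    exact J.zero_mem
  · rw [sub_zero]
    exact hT y hy

end FormalSum

namespace Contramodule

variable {C : Contramodule R}

instance : SMul R C := ⟨fun r c => C.contra (r • point c)⟩

theorem contra_smul (r : R) (a : FormalSum R C) : C.contra (r • a) = r • C.contra a := by
  have h := C.contra_join (r • point a)
  rwa [join_eq_bind, FormalSum.bind_smul, point_bind, FormalSum.map_smul, map_point] at h

instance : Module R C :=
  Function.Surjective.module R C.contraHom (fun c => ⟨point c, C.contra_point c⟩) contra_smul

/-- The `R`-linear map `R[[X]] → C`, `∑ rₓ x ↦ ∑ rₓ g(x)`, extending a family of elements of `C`;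
the infinite sum is the one given by the contraaction. -/
def linearCombination {X : Type v} (g : X → C) : FormalSum R X →ₗ[R] C where
  toFun a := C.contra (map g a)
  map_add' a b := by
    rw [Contra.map_add]
    exact C.contraHom.map_add _ _
  map_smul' r a := by rw [FormalSum.map_smul, contra_smul, RingHom.id_apply]

theorem linearCombination_point {X : Type v} (g : X → C) (x : X) :
    linearCombination g (point (R := R) x) = g x :=
  (congrArg C.contra (map_point g x)).trans (C.contra_point _)

theorem linearCombination_id (a : FormalSum R C) : linearCombination id a = C.contra a :=
  congrArg C.contra (map_id a)

end Contramodule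

namespace Hom

variable {C D : Contramodule R}

theorem map_smul (f : C ⟶ D) (r : R) (c : C) : f.toFun (r • c) = r • f.toFun c := by
  rw [← C.contra_point c, ← Contramodule.contra_smul, f.map_contra, FormalSum.map_smul,
    Contramodule.contra_smul, ← f.map_contra]

theorem mem_ker {f : C ⟶ D} {c : C} : c ∈ f.toAddHom.ker ↔ f.toFun c = 0 :=
  Iff.rfl

theorem smul_mem_ker {f : C ⟶ D} (r : R) {c : C} (hc : c ∈ f.toAddHom.ker) :
    r • c ∈ f.toAddHom.ker := by
  rw [mem_ker, map_smul, mem_ker.1 hc, smul_zero]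

theorem epi_of_surjective {f : C ⟶ D} (hf : Function.Surjective f.toFun) : Epi f where
  left_cancellation g h hgh := hom_ext fun d => by
    obtain ⟨c, rfl⟩ := hf d
    exact congrArg (fun k : C ⟶ _ => k.toFun c) hgh

theorem isIso_of_bijective {f : C ⟶ D} (hf : Function.Bijective f.toFun) : IsIso f := by
  let e := Equiv.ofBijective f.toFun hf
  refine ⟨⟨e.symm, fun r => hf.injective ?_⟩, hom_ext e.symm_apply_apply,
    hom_ext e.apply_symm_apply⟩
  rw [f.map_contra, map_map, show f.toFun ∘ e.symm = id from funext e.apply_symm_apply, map_id]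
  exact e.apply_symm_apply _

end Hom

section FreeContramodule

variable {X : Type u} {C : Contramodule R}

theorem free_hom_ext {f g : free R X ⟶ C} (h : ∀ x, f.toFun (point x) = g.toFun (point x)) :
    f = g :=
  hom_ext fun a =>
    (free_hom_apply f a).trans (funext h ▸ (free_hom_apply g a).symm)

theorem freeLift_eq_id : freeLift (C := free R X) point = 𝟙 (free R X) :=
  free_hom_ext fun x => freeLift_point _ x

theorem freeLift_sub (g h : X → C) (a : free R X) :
    (freeLift fun x => g x - h x).toFun a = (freeLift g).toFun a - (freeLift h).toFun a :=
  Contramodule.contra_map_sub g h a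

theorem epi_freeLift_id (C : Contramodule R) : Epi (freeLift (C := C) id) :=
  Hom.epi_of_surjective fun c => ⟨point c, freeLift_point _ c⟩

end FreeContramodule

section ContraSpan

open Contramodule

variable {J : Submodule Rᵐᵒᵖ R} {C D : Contramodule R}

/-- The subgroup `J S ⊆ C` of all the infinite sums `∑ r_s s` with coefficients in the right ideal
`J` and `s ∈ S`, obtained by applying the contraaction to formal linear combinations.  For
`S = Set.univ` this is the subgroup `J C`; it is not stable under `R` unless `J` is two-sided. -/
def contraSpan (J : Submodule Rᵐᵒᵖ R) (S : Set C) : AddSubgroup C :=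
  (FormalSum.coeffIn J S).map C.contraHom

theorem linearCombination_mem_contraSpan (hJ : IsOpen (J : Set R)) {X : Type v} {S : Set X}
    {T : Set C} {g : X → C} (hg : Set.MapsTo g S T) {a : FormalSum R X}
    (ha : a ∈ FormalSum.coeffIn J S) : linearCombination g a ∈ contraSpan J T :=
  ⟨map g a, FormalSum.map_mem_coeffIn hJ hg ha, rfl⟩

theorem Hom.map_mem_contraSpan (hJ : IsOpen (J : Set R)) (f : C ⟶ D) {S : Set C} {T : Set D}
    (hf : Set.MapsTo f.toFun S T) {c : C} (hc : c ∈ contraSpan J S) :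
    f.toFun c ∈ contraSpan J T := by
  obtain ⟨a, ha, rfl⟩ := hc
  exact f.map_contra a ▸ linearCombination_mem_contraSpan hJ hf ha

theorem smul_mem_contraSpan_univ {r : R} (hr : r ∈ J) (c : C) :
    r • c ∈ contraSpan J (Set.univ : Set C) :=
  ⟨r • point c, FormalSum.mem_coeffIn_univ.2 fun x =>
    J.smul_mem (MulOpposite.op ((point (R := R) c).1 x)) hr, rfl⟩

theorem linearCombination_sub_sum_mem_contraSpan (hJ : IsOpen (J : Set R)) {X : Type v}
    (g : X → C) {a : FormalSum R X} {T : Finset X} (hT : ∀ x ∉ T, a.1 x ∈ J) :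
    linearCombination g a - ∑ x ∈ T, a.1 x • g x ∈ contraSpan J (Set.univ : Set C) := by
  have h := linearCombination_mem_contraSpan hJ (Set.mapsTo_univ g _)
    (FormalSum.sub_sum_smul_point_mem_coeffIn hT)
  simpa only [_root_.map_sub, _root_.map_sum, _root_.map_smul, linearCombination_point] using h

theorem mem_contraSpan_univ_iff (hJ : IsOpen (J : Set R)) {X : Type u} {a : free R X} :
    a ∈ contraSpan J (Set.univ : Set (free R X)) ↔ ∀ x, a.1 x ∈ J := by
  refine ⟨?_, fun ha => ?_⟩
  · rintro ⟨b, hb, rfl⟩ x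
    exact FormalSum.join_apply_mem hJ hb.1 x
  · have hpoint : linearCombination (C := free R X) point a = a :=
      (join_map point a).trans (bind_point a)
    exact hpoint ▸ linearCombination_mem_contraSpan (C := free R X) hJ (Set.mapsTo_univ point _)
      (FormalSum.mem_coeffIn_univ.2 ha)

theorem eq_zero_of_forall_mem_contraSpan {X : Type u} {a : free R X}
    (h : ∀ I : Submodule Rᵐᵒᵖ R, IsOpen (I : Set R) →
      a ∈ contraSpan I (Set.univ : Set (free R X))) : a = 0 := by
  refine Subtype.ext (funext fun x => ?_)
  have hzero : (0 : free R X).1 x = 0 := (tsum_congr fun _ => zero_mul _).trans tsum_zero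
  rw [hzero]
  exact eq_zero_of_forall_mem_isOpen (A := Rᵐᵒᵖ) fun I hI =>
    (mem_contraSpan_univ_iff hI).1 (h I hI) x

end ContraSpan

section CyclicModules

open Contramodule

variable {J : Submodule Rᵐᵒᵖ R}

/-- The class of an element of `N ⊗ C` in the contratensor product `N ⊙ C`. -/
def Contratensor.mk (N : Type u) [AddCommGroup N] [Module Rᵐᵒᵖ N] (C : Contramodule R) :
    N ⊗[ℤ] C →+ Contratensor N C :=
  QuotientAddGroup.mk' (contratensorRel N C)

theorem Contratensor.mk_eq_zero_iff {N : Type u} [AddCommGroup N] [Module Rᵐᵒᵖ N]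
    {C : Contramodule R} {t : N ⊗[ℤ] C} : mk N C t = 0 ↔ t ∈ contratensorRel N C :=
  QuotientAddGroup.eq_zero_iff t

variable (J) in
/-- The homomorphism `C → R/J ⊙ C`, `c ↦ 1 ⊗ c`, whose kernel is `J C` if `J` is open. -/
def oneTensor (C : Contramodule R) : C →+ Contratensor (R ⧸ J) C :=
  (Contratensor.mk (R ⧸ J) C).comp
    (TensorProduct.mk ℤ (R ⧸ J) C (Submodule.Quotient.mk 1)).toAddMonoidHom

theorem oneTensor_apply {C : Contramodule R} (c : C) :
    oneTensor J C c = Contratensor.mk (R ⧸ J) C (Submodule.Quotient.mk 1 ⊗ₜ[ℤ] c) :=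
  rfl

theorem map_oneTensor [IsDiscreteModule R (R ⧸ J)] {C D : Contramodule R} (f : C ⟶ D) (c : C) :
    Contratensor.map (R ⧸ J) f (oneTensor J C c) = oneTensor J D (f.toFun c) :=
  rfl

theorem oneTensor_contra {C : Contramodule R} (a : FormalSum R C) :
    oneTensor J C (C.contra a) = Contratensor.mk (R ⧸ J) C
      (∑ᶠ c : C, Submodule.Quotient.mk (a.1 c) ⊗ₜ[ℤ] c) := by
  have hone : ∀ r : R, MulOpposite.op r • (Submodule.Quotient.mk 1 : R ⧸ J)
      = Submodule.Quotient.mk r := fun r => by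
    rw [← Submodule.Quotient.mk_smul, op_smul_eq_mul, one_mul]
  rw [oneTensor_apply, ← sub_eq_zero, ← _root_.map_sub]
  refine Contratensor.mk_eq_zero_iff.2 (AddSubgroup.subset_closure ⟨Submodule.Quotient.mk 1, a, ?_⟩)
  simp only [hone]

theorem oneTensor_smul {C : Contramodule R} (r : R) (c : C) :
    oneTensor J C (r • c) = Contratensor.mk (R ⧸ J) C (Submodule.Quotient.mk r ⊗ₜ[ℤ] c) := by
  classical
  rw [← C.contra_point c, ← contra_smul, oneTensor_contra, finsum_eq_single _ c, C.contra_point]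
  · rw [FormalSum.smul_point_apply, if_pos rfl]
  · intro d hd
    rw [FormalSum.smul_point_apply, if_neg hd.symm, Submodule.Quotient.mk_zero,
      TensorProduct.zero_tmul]

theorem oneTensor_surjective (C : Contramodule R) : Function.Surjective (oneTensor J C) := by
  rw [← AddMonoidHom.range_eq_top, eq_top_iff]
  rintro ⟨t⟩ -
  induction t using TensorProduct.induction_on with
  | zero => exact zero_mem _
  | tmul n c =>
    obtain ⟨r, rfl⟩ := Submodule.Quotient.mk_surjective J n
    exact ⟨r • c, oneTensor_smul r c⟩
  | add s t hs ht => exact add_mem hs ht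

variable (J) in
/-- The biadditive pairing `R/J × C → C / J C`, `(r, c) ↦ r c`. -/
def quotientSMul (C : Contramodule R) : (R ⧸ J) →+ C →+ C ⧸ contraSpan J (Set.univ : Set C) :=
  QuotientAddGroup.lift J.toAddSubgroup
    ((AddMonoidHom.compHom (QuotientAddGroup.mk' (contraSpan J (Set.univ : Set C)))).comp
      (smulAddHom R C))
    fun _ hr => AddMonoidHom.ext fun c =>
      (QuotientAddGroup.eq_zero_iff _).2 (smul_mem_contraSpan_univ hr c)

variable (J) in
/-- The homomorphism `R/J ⊗ C → C / J C`, `r ⊗ c ↦ r c`, which factors through `R/J ⊙ C` and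
provides the inverse of the map `C / J C → R/J ⊙ C` induced by `oneTensor`. -/
def quotientTensorMap (C : Contramodule R) :
    (R ⧸ J) ⊗[ℤ] C →+ C ⧸ contraSpan J (Set.univ : Set C) :=
  TensorProduct.liftAddHom (quotientSMul J C) fun z n c => by
    rw [_root_.map_zsmul, _root_.map_zsmul, AddMonoidHom.coe_smul, Pi.smul_apply]

theorem quotientTensorMap_tmul {C : Contramodule R} (r : R) (c : C) :
    quotientTensorMap J C (Submodule.Quotient.mk r ⊗ₜ[ℤ] c) = QuotientAddGroup.mk' _ (r • c) :=
  rfl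

theorem quotientTensorMap_finsum (hJ : IsOpen (J : Set R)) {C : Contramodule R}
    (a : FormalSum R C) :
    quotientTensorMap J C (∑ᶠ c : C, Submodule.Quotient.mk (a.1 c) ⊗ₜ[ℤ] c)
      = QuotientAddGroup.mk' _ (C.contra a) := by
  have hfin := FormalSum.finite a J hJ
  have hsupp : Function.support (fun c : C => (Submodule.Quotient.mk (a.1 c) : R ⧸ J) ⊗ₜ[ℤ] c)
      ⊆ hfin.toFinset := fun c hc => hfin.mem_toFinset.2 fun hcJ => hc <| by
    simp only [(Submodule.Quotient.mk_eq_zero J).2 hcJ, TensorProduct.zero_tmul]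
  have hmod := linearCombination_sub_sum_mem_contraSpan hJ id (a := a) (T := hfin.toFinset)
    fun c hc => not_not.1 (mt hfin.mem_toFinset.2 hc)
  rw [linearCombination_id] at hmod
  rw [finsum_eq_sum_of_support_subset _ hsupp, _root_.map_sum]
  simp only [quotientTensorMap_tmul]
  rw [← _root_.map_sum, eq_comm, ← sub_eq_zero, ← _root_.map_sub]
  exact (QuotientAddGroup.eq_zero_iff _).2 hmod

theorem contratensorRel_le_ker_quotientTensorMap (hJ : IsOpen (J : Set R)) (C : Contramodule R) :
    contratensorRel (R ⧸ J) C ≤ (quotientTensorMap J C).ker := by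
  refine (AddSubgroup.closure_le _).2 ?_
  rintro _ ⟨n, a, rfl⟩
  obtain ⟨r, rfl⟩ := Submodule.Quotient.mk_surjective J n
  have hsum := quotientTensorMap_finsum hJ (r • a)
  rw [contra_smul, ← quotientTensorMap_tmul] at hsum
  exact ((quotientTensorMap J C).map_sub _ _).trans (sub_eq_zero.2 hsum.symm)

theorem ker_oneTensor (hJ : IsOpen (J : Set R)) (C : Contramodule R) :
    (oneTensor J C).ker = contraSpan J (Set.univ : Set C) := by
  refine le_antisymm (fun c hc => ?_) ?_
  · have hc' : quotientTensorMap J C (Submodule.Quotient.mk 1 ⊗ₜ[ℤ] c) = 0 :=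
      contratensorRel_le_ker_quotientTensorMap hJ C (Contratensor.mk_eq_zero_iff.1 hc)
    rw [quotientTensorMap_tmul, one_smul] at hc'
    exact (QuotientAddGroup.eq_zero_iff c).1 hc'
  · rintro _ ⟨a, ha, rfl⟩
    refine (oneTensor_contra a).trans ?_
    simp only [(Submodule.Quotient.mk_eq_zero J).2 (ha.1 _), TensorProduct.zero_tmul, finsum_zero]
    exact _root_.map_zero _

end CyclicModules

section PureKernels

variable {F : Contramodule R}

/-- The kernel of `f : C ⟶ D` is pure if `ker f ∩ J C = J (ker f)` for all open right ideals `J`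
(the inclusion of the right-hand side is automatic); this is the form in which flatness of `D` is
used when `C` is free. -/
def HasPureKernel {C D : Contramodule R} (f : C ⟶ D) : Prop :=
  ∀ J : Submodule Rᵐᵒᵖ R, IsOpen (J : Set R) →
    f.toAddHom.ker ⊓ contraSpan J Set.univ ≤ contraSpan J f.toAddHom.ker

theorem Resolution.exists_map_d_eq (Q : Resolution F) (N : Type u) [AddCommGroup N]
    [Module Rᵐᵒᵖ N] [IsDiscreteModule R N] (i : ℕ) [hQ : Subsingleton (Q.homology N (i + 1))]
    {t : Contratensor N (Q.X (i + 1))} (ht : Contratensor.map N (Q.d i) t = 0) :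
    ∃ s, Contratensor.map N (Q.d (i + 1)) s = t := by
  have hzero : (QuotientAddGroup.mk (⟨t, ht⟩ : Q.cycles N (i + 1)) : Q.homology N (i + 1)) = 0 :=
    hQ.elim _ _
  exact (QuotientAddGroup.eq_zero_iff _).1 hzero

theorem Resolution.ker_aug_inf_contraSpan_le (Q : Resolution F) (J : Submodule Rᵐᵒᵖ R)
    [IsDiscreteModule R (R ⧸ J)] [Subsingleton (Q.homology (R ⧸ J) 1)] :
    Q.aug.toAddHom.ker ⊓ contraSpan J Set.univ ≤ contraSpan J Q.aug.toAddHom.ker := by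
  have hJ : IsOpen (J : Set R) := isDiscreteModule_quotient_iff.1 inferInstance
  rintro y ⟨hy, hyJ⟩
  obtain ⟨z, rfl⟩ := (Q.exact_zero y).1 hy
  have hcycle : Contratensor.map (R ⧸ J) (Q.d 0) (oneTensor J _ z) = 0 := by
    rw [map_oneTensor]
    exact (ker_oneTensor hJ _).ge hyJ
  obtain ⟨t, ht⟩ := Q.exists_map_d_eq (R ⧸ J) 0 hcycle
  obtain ⟨w, rfl⟩ := oneTensor_surjective _ t
  have hzw : z - (Q.d 1).toFun w ∈ contraSpan J Set.univ := by
    rw [← ker_oneTensor hJ, AddMonoidHom.mem_ker, _root_.map_sub, ← map_oneTensor, ht, sub_self]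
  have hd : (Q.d 0).toFun (z - (Q.d 1).toFun w) = (Q.d 0).toFun z := by
    refine ((Q.d 0).toAddHom.map_sub _ _).trans ?_
    exact sub_eq_self.2 ((Q.exact_succ 0 _).2 ⟨w, rfl⟩)
  rw [← hd]
  exact (Q.d 0).map_mem_contraSpan hJ (fun x _ => (Q.exact_zero _).2 ⟨x, rfl⟩) hzw

theorem IsOneStrictlyFlat.hasPureKernel (hF : IsOneStrictlyFlat F) :
    HasPureKernel (freeLift (C := F) id) := fun J hJ =>
  have := isDiscreteModule_quotient_iff.2 hJ
  have : Subsingleton ((standardResolution F).homology (R ⧸ J) 1) := hF (R ⧸ J)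
  (standardResolution F).ker_aug_inf_contraSpan_le J

end PureKernels

section ProjectiveCovers

open Contramodule

variable {F P : Contramodule R} {X : Type u} {q : free R X ⟶ F} {I : Submodule Rᵐᵒᵖ R}

theorem HasPureKernel.exists_sub_sum_smul_mem (hq : HasPureKernel q) (hI : IsOpen (I : Set R))
    {a : free R X} (ha : a ∈ q.toAddHom.ker) {T : Finset X} (hT : ∀ x ∉ T, a.1 x ∈ I) :
    ∃ c : X → free R X, (∀ x, c x ∈ q.toAddHom.ker) ∧
      a - ∑ x ∈ T, a.1 x • c x ∈ contraSpan I Set.univ := by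
  let J : Submodule Rᵐᵒᵖ R := I ⊔ Submodule.span Rᵐᵒᵖ (a.1 '' T)
  have hIJ : I ≤ J := le_sup_left
  have hJ : IsOpen (J : Set R) :=
    AddSubgroup.isOpen_mono (H₁ := I.toAddSubgroup) (H₂ := J.toAddSubgroup) hIJ hI
  have haJ : ∀ x, a.1 x ∈ J := fun x => by
    by_cases hx : x ∈ T
    · exact (le_sup_right : _ ≤ J) (Submodule.subset_span ⟨x, hx, rfl⟩)
    · exact hIJ (hT x hx)
  obtain ⟨j, ⟨hjJ, hjker⟩, hja⟩ := hq J hJ ⟨ha, (mem_contraSpan_univ_iff hJ).2 haJ⟩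
  choose s hs using fun κ => exists_sub_sum_mul_mem_of_mem_sup_span (hjJ κ)
  have hfin := FormalSum.finite j I hI
  have hker : ∀ κ ∈ hfin.toFinset, κ ∈ q.toAddHom.ker := fun κ hκ =>
    hjker fun h0 => hfin.mem_toFinset.1 hκ (h0.symm ▸ I.zero_mem)
  refine ⟨fun x => ∑ κ ∈ hfin.toFinset, s κ x • κ,
    fun x => sum_mem fun κ hκ => Hom.smul_mem_ker _ (hker κ hκ), ?_⟩
  have htail : a - ∑ κ ∈ hfin.toFinset, j.1 κ • κ ∈ contraSpan I Set.univ := by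
    have h := linearCombination_sub_sum_mem_contraSpan hI id (a := j) (T := hfin.toFinset)
      fun κ hκ => not_not.1 (mt hfin.mem_toFinset.2 hκ)
    rw [linearCombination_id] at h
    exact hja ▸ h
  have herror : ∑ κ ∈ hfin.toFinset, (j.1 κ - ∑ x ∈ T, a.1 x * s κ x) • κ
      ∈ contraSpan I Set.univ := sum_mem fun κ _ => smul_mem_contraSpan_univ (hs κ) κ
  convert add_mem htail herror using 1
  simp only [sub_smul, Finset.sum_smul, Finset.sum_sub_distrib, Finset.smul_sum, mul_smul]
  rw [Finset.sum_comm, sub_add_sub_cancel]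

theorem HasPureKernel.exists_sub_freeLift_mem (hq : HasPureKernel q) (hI : IsOpen (I : Set R))
    {a : free R X} (ha : a ∈ q.toAddHom.ker) :
    ∃ c : X → free R X, (∀ x, c x ∈ q.toAddHom.ker) ∧
      a - (freeLift c).toFun a ∈ contraSpan I Set.univ := by
  have hfin := FormalSum.finite a I hI
  have hT : ∀ x ∉ hfin.toFinset, a.1 x ∈ I := fun x hx => not_not.1 (mt hfin.mem_toFinset.2 hx)
  obtain ⟨c, hc, hac⟩ := hq.exists_sub_sum_smul_mem hI ha hT
  have hrest := sub_mem hac (linearCombination_sub_sum_mem_contraSpan hI c hT)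
  rw [sub_sub_sub_cancel_right] at hrest
  exact ⟨c, hc, hrest⟩

theorem HasPureKernel.exists_hom_mem_contraSpan (hq : HasPureKernel q) (hI : IsOpen (I : Set R))
    {a : free R X} (ha : a ∈ q.toAddHom.ker) :
    ∃ ψ : free R X ⟶ free R X, ψ ≫ q = q ∧ ψ.toFun a ∈ contraSpan I Set.univ := by
  obtain ⟨c, hc, hac⟩ := hq.exists_sub_freeLift_mem hI ha
  let basis : X → free R X := point
  refine ⟨freeLift fun x => basis x - c x, free_hom_ext fun x => ?_, ?_⟩
  · calc (freeLift (fun x => basis x - c x) ≫ q).toFun (point x)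
        = q.toAddHom (basis x - c x) := congrArg q.toFun (freeLift_point _ x)
      _ = q.toAddHom (basis x) := by rw [_root_.map_sub, AddMonoidHom.mem_ker.1 (hc x), sub_zero]
  · rw [freeLift_sub, freeLift_eq_id]
    exact hac

theorem IsProjectiveCover.injective [Epi q] (hq : HasPureKernel q) {p : P ⟶ F}
    (hp : IsProjectiveCover p) : Function.Injective p.toFun := by
  have := hp.projective
  have := hp.epi
  let u : P ⟶ free R X := Projective.factorThru p q
  let v : free R X ⟶ P := Projective.factorThru q p
  have hu : u ≫ q = p := Projective.factorThru_comp p q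
  have hv : v ≫ p = q := Projective.factorThru_comp q p
  have hmem : ∀ k ∈ p.toAddHom.ker, ∀ I : Submodule Rᵐᵒᵖ R, IsOpen (I : Set R) →
      u.toFun k ∈ contraSpan I (Set.univ : Set (free R X)) := by
    intro k hk I hI
    have huk : u.toFun k ∈ q.toAddHom.ker := by
      rwa [Hom.mem_ker, ← comp_toFun, hu]
    obtain ⟨ψ, hψ, hψk⟩ := hq.exists_hom_mem_contraSpan hI huk
    have := hp.isIso_of_comp_eq (u ≫ ψ ≫ v) (by simp only [Category.assoc, hv, hψ, hu])
    have hu_eq : u = u ≫ ψ ≫ v ≫ inv (u ≫ ψ ≫ v) ≫ u := by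
      simpa only [Category.assoc] using (IsIso.hom_inv_id_assoc (u ≫ ψ ≫ v) u).symm
    rw [hu_eq, comp_toFun, comp_toFun]
    exact (v ≫ inv (u ≫ ψ ≫ v) ≫ u).map_mem_contraSpan hI (Set.mapsTo_univ _ _) hψk
  have := hp.isIso_of_comp_eq (u ≫ v) (by rw [Category.assoc, hv, hu])
  refine (injective_iff_map_eq_zero p.toAddHom).2 fun k hk => ?_
  have huk : u.toFun k = 0 := eq_zero_of_forall_mem_contraSpan (hmem k hk)
  calc k = (u ≫ v ≫ inv (u ≫ v)).toFun k := by
        rw [← Category.assoc, IsIso.hom_inv_id, id_toFun]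
    _ = (v ≫ inv (u ≫ v)).toAddHom (u.toFun k) := comp_toFun _ _ _
    _ = 0 := by rw [huk, _root_.map_zero]

end ProjectiveCovers

end

end

end Contra

theorem proposition3p4_general {R : Type u} [Ring R] [UniformSpace R] [IsUniformAddGroup R]
    [IsTopologicalRing R] [CompleteSpace R] [T2Space R] [IsLinearTopology Rᵐᵒᵖ R]
    (F : Contra.Contramodule R) (hF : Contra.IsOneStrictlyFlat F)
    (P : Contra.Contramodule R) (p : P ⟶ F) (hp : Contra.IsProjectiveCover p) :
    IsIso p ∧ Projective F := by
  have := hp.epi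
  have := Contra.epi_freeLift_id F
  have : IsIso p :=
    Contra.Hom.isIso_of_bijective ⟨hp.injective hF.hasPureKernel, Contra.surjective_of_epi p⟩
  exact ⟨this, Projective.of_iso (asIso p) hp.projective⟩

theorem proposition3p4 {R : Type u} [Ring R] [UniformSpace R] [IsUniformAddGroup R]
    [IsTopologicalRing R] [CompleteSpace R] [T2Space R] [IsLinearTopology Rᵐᵒᵖ R]
    (hR : (𝓝 (0 : R)).HasBasis (fun I : TwoSidedIdeal R => IsOpen (I : Set R))
      (fun I : TwoSidedIdeal R => (I : Set R)))
    (F : Contra.Contramodule R) (hF : Contra.IsOneStrictlyFlat F)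
    (P : Contra.Contramodule R) (p : P ⟶ F) (hp : Contra.IsProjectiveCover p) :
    IsIso p ∧ Projective F :=
  proposition3p4_general F hF P p hp
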